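/- All graphs are finite, simple and undirected. A graph $X$ is called distance-hereditary if, in every connected induced subgraph $Y$ of $X$, the distance between any two vertices of $Y$ is the same as their distance in $X$ (the graph $X$ itself need not be connected). For $d\ge 1$, the $d$-dimensional Weisfeiler-Leman algorithm ($d$-dim WL) colors the $d$-tuples of vertices of a graph $X=(\Omega,E)$ in rounds. Initially, $v=(v_1,\dots,v_d)\in\Omega^d$ has the color $c_0(v)=\operatorname{atp}(v)$, the atomic type of $v$, which records for all $i,j$ whether $v_i=v_j$ and whether $v_i$ and $v_j$ are adjacent. In round $i+1$ it receives the color $$c_{i+1}(v)=\Bigl(c_i(v),\ \bigl\{\!\!\bigl\{\bigl(\operatorname{atp}(v_1,\dots,v_d,w),\,c_i(v[1\to w]),\dots,c_i(v[d\to w])\bigr):\ w\in\Omega\bigr\}\!\!\bigr\}\Bigr),$$ where $v[j\to w]$ is $v$ with its $j$-th entry replaced by $w$, and double braces denote multisets. For $d=1$ this is color refinement, and for $d=2$ it is the ordinary Weisfeiler-Leman algorithm. The $d$-dim WL does not distinguish two graphs if, for every $i$, each color $c_i$ occurs equally often in both graphs; it identifies $X$ if, for every graph $Y$, it does not distinguish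 $X$ and $Y$ if and only if $X$ and $Y$ are isomorphic. The WL-dimension of $X$ is the smallest positive integer $d_X$ such that the $d$-dim WL identifies $X$ for all $d\ge d_X$. The WL-dimension of a class of graphs is the maximum of the WL-dimensions of the graphs in the class. **Theorem.** The Weisfeiler-Leman dimension of the class of finite distance-hereditary graphs is equal to $2$. -/

import Mathlib

universe u

namespace WeisfeilerLeman

/-- Atomic types of `d`-tuples of vertices: the `(i, j)` entry records whether the `i`-th and
the `j`-th vertex are equal, and whether they are adjacent. -/
def AtomicType (d : ℕ) : Type := Fin d → Fin d → Prop × Prop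

/-- The atomic type of a `d`-tuple `v` of vertices of the graph `G`. -/
def atomicType {V : Type u} (G : SimpleGraph V) {d : ℕ} (v : Fin d → V) : AtomicType d :=
  fun i j => (v i = v j, G.Adj (v i) (v j))

/-- The colors which the `d`-dimensional Weisfeiler-Leman algorithm can assign to `d`-tuples
in the given round. They do not depend on the graph, so that colors arising from different
graphs can be compared. -/
def Color (d : ℕ) : ℕ → Type
  | 0 => AtomicType d
  | i + 1 => Color d i × Multiset (AtomicType (d + 1) × (Fin d → Color d i))

/-- The coloring of the `d`-tuples of vertices of a finite graph after the given number of rounds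
of the `d`-dimensional Weisfeiler-Leman algorithm. Initially a tuple is colored by its atomic type.
In each round the color of `v = (v₁, …, v_d)` is refined by the multiset, over all vertices `w`,
of the atomic type of `(v₁, …, v_d, w)` together with the old colors of the `d` tuples obtained
from `v` by replacing one entry with `w`.

For `d ≥ 2` the atomic type of `(v₁, …, v_d, w)` is redundant (and `d = 2` is the ordinary
Weisfeiler-Leman algorithm). For `d = 1` it separates the neighbors of `v₁` from the other
vertices, and the procedure is color refinement. -/
def color {V : Type u} [Fintype V] (G : SimpleGraph V) (d : ℕ) :
    (i : ℕ) → (Fin d → V) → Color d i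
  | 0, v => atomicType G v
  | i + 1, v =>
      (color G d i v,
        (Finset.univ : Finset V).val.map fun w =>
          (atomicType G (Fin.snoc (α := fun _ => V) v w),
            fun j => color G d i (Function.update v j w)))

/-- The `d`-dimensional Weisfeiler-Leman algorithm does not distinguish `G` from `H`:
after every round, each color occurs equally often in both graphs. -/
def Indistinguishable (d : ℕ) {V W : Type u} [Fintype V] [Fintype W]
    (G : SimpleGraph V) (H : SimpleGraph W) : Prop :=
  ∀ i : ℕ, (Finset.univ : Finset (Fin d → V)).val.map (color G d i) =
    (Finset.univ : Finset (Fin d → W)).val.map (color H d i)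

/-- The `d`-dimensional Weisfeiler-Leman algorithm identifies `G`: it correctly tests isomorphism
between `G` and any other finite graph. -/
def Identifies (d : ℕ) {V : Type u} [Fintype V] (G : SimpleGraph V) : Prop :=
  ∀ (W : Type u) [Fintype W] (H : SimpleGraph W),
    Indistinguishable d G H ↔ Nonempty (G ≃g H)

/-- The Weisfeiler-Leman dimension of a finite graph `G`: the smallest positive integer `d₀` such
that for every `d ≥ d₀` the `d`-dimensional Weisfeiler-Leman algorithm identifies `G`. -/
noncomputable def graphDim {V : Type u} [Fintype V] (G : SimpleGraph V) : ℕ∞ :=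
  sInf {D : ℕ∞ | ∃ d₀ : ℕ, D = d₀ ∧ 1 ≤ d₀ ∧ ∀ d : ℕ, d₀ ≤ d → Identifies d G}

/-- The Weisfeiler-Leman dimension of a class `K` of graphs: the maximum (`⊤` if unbounded) of the
Weisfeiler-Leman dimensions of the finite graphs that belong to `K`. -/
noncomputable def classDim (K : ∀ V : Type u, SimpleGraph V → Prop) : ℕ∞ :=
  sSup {D : ℕ∞ | ∃ (V : Type u) (_ : Fintype V) (G : SimpleGraph V), K V G ∧ D = graphDim G}

/-- A graph is distance-hereditary if in each of its connected induced subgraphs the distance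
between any two vertices is the same as in the whole graph. -/
def DistanceHereditary (V : Type u) (G : SimpleGraph V) : Prop :=
  ∀ S : Set V, (G.induce S).Connected →
    ∀ x y : S, (G.induce S).dist x y = G.dist (x : V) (y : V)

end WeisfeilerLeman

/-!
The upper bound combines two facts.

Every distance-hereditary graph with at least two vertices has a pair of twins or a pendant vertex
(`WalkHereditary.prunable`), and this is inherited by induced subgraphs. It is proved by arranging
the vertices of a connected graph according to their distance to a fixed vertex. By
`WalkHereditary.adj_of_walk`, vertices of one level that are joined above have the same neighbors
in the level below. Hence a nontrivial component of the last level is a module, and if the last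
level has no edges then so is the neighborhood of a vertex of it with the fewest neighbors. A module
with a common neighbor outside contains no induced path on four vertices, and so contains twins
(`WalkHereditary.exists_twins_of_module`).

If `d`-dimensional Weisfeiler-Leman with `d ≥ 2` does not distinguish two graphs, then Duplicator
wins the bijective game with two pebble pairs (`strategy_colorRel`): the first two entries of
the tuples of equal color serve as pebbles. Being twins and being pendant are visible in
this game. So one may collapse all classes of twins, or, if there are none, remove all
pendant vertices, simultaneously in both graphs. Both operations identify the points in the fibers
of a map, and the strategy passes to the fibers: matched fibers have equal size, so
that Hall's theorem turns a bijection of the vertices into one of the fibers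
(`exists_equiv_of_card_fiber_eq`). By induction the smaller graphs are isomorphic. Requiring the
isomorphism to map each vertex to one that Duplicator could choose keeps track of what has been
collapsed, without any vertex colors, and allows to lift it (`Strategy.exists_lift`).

For the lower bound, the disjoint union of two triangles is distance-hereditary, but color
refinement does not distinguish it from the cycle of length six.
-/

namespace WeisfeilerLeman

/-! ### The bijective pebble game -/

/-- The back-and-forth property of a set `R` of positions `(x, y; x', y')` of the bijective pebble
game on `V` and `W`: from each position there is a bijection `σ` such that either of the two pebble
pairs can be moved to any pair `(z, σ z)` without leaving `R`. -/
def BackForth {V W : Type u} (R : V → V → W → W → Prop) : Prop :=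
  ∀ ⦃x y x' y'⦄, R x y x' y' → ∃ σ : V ≃ W, ∀ z, R x z x' (σ z) ∧ R z y (σ z) y'

/-- A winning strategy for Duplicator in the bijective game with two pebble pairs on `G` and `H`:
a set of positions with the back-and-forth property, all of which are partial isomorphisms. -/
structure Strategy {V W : Type u} (G : SimpleGraph V) (H : SimpleGraph W)
    (R : V → V → W → W → Prop) : Prop where
  eq_iff : ∀ ⦃x y x' y'⦄, R x y x' y' → (x = y ↔ x' = y')
  adj_iff : ∀ ⦃x y x' y'⦄, R x y x' y' → (G.Adj x y ↔ H.Adj x' y')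
  forth : BackForth R

section Strategy

variable {V W : Type u} {G : SimpleGraph V} {H : SimpleGraph W} {R : V → V → W → W → Prop}

lemma Strategy.diag_right (h : Strategy G H R) {x y x' y'} (hR : R x y x' y') : R y y y' y' := by
  obtain ⟨σ, hσ⟩ := h.forth hR
  have h1 := (hσ y).2
  rwa [(h.eq_iff h1).1 rfl] at h1

/-- Every vertex of the second graph can be pebbled from any given position. -/
lemma Strategy.exists_diag (h : Strategy G H R) {x y x' y'} (hR : R x y x' y') (z' : W) :
    ∃ z, R z z z' z' := by
  obtain ⟨σ, hσ⟩ := h.forth hR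
  have := h.diag_right (hσ (σ.symm z')).1
  exact ⟨σ.symm z', by simpa using this⟩

end Strategy

/-! ### Collapsing the fibers of a map -/

section Collapse

open Finset in
/-- If a bijection `σ` matches elements lying in fibers of `p` and `q` of equal size, then there is
a bijection between the fibers such that each fiber of `p` contains an element that `σ` sends into
the corresponding fiber of `q`. Hall's condition holds as the weights `1 / (size of the fiber)`
sum up to the number of fibers, and `σ` preserves the weights. -/
lemma exists_equiv_of_card_fiber_eq {V W V' W' : Type u} [Fintype V] [Fintype W] [Fintype V']
    [Fintype W'] [DecidableEq V'] [DecidableEq W'] {p : V → V'} {q : W → W'}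
    (hp : p.Surjective) (hq : q.Surjective) (σ : V ≃ W)
    (hσ : ∀ z, #{w | p w = p z} = #{w | q w = q (σ z)}) :
    ∃ τ : V' ≃ W', ∀ Z, ∃ z, p z = Z ∧ q (σ z) = τ Z := by
  have weight : ∀ {A A' : Type u} [Fintype A] [Fintype A'] [DecidableEq A'] (r : A → A')
      (_ : r.Surjective) (S : Finset A'),
      ∑ a with r a ∈ S, (1 / (#{b | r b = r a} : ℚ)) = #S := by
    intro A A' _ _ _ r hr S
    rw [← Finset.sum_fiberwise_of_maps_to (s := ({a | r a ∈ S} : Finset A)) (t := S) (g := r)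
      (by simp)]
    rw [Finset.card_eq_sum_ones, Nat.cast_sum]
    refine Finset.sum_congr rfl fun Z hZ => ?_
    have h1 : ((univ.filter fun a => r a ∈ S).filter fun a => r a = Z)
        = univ.filter fun a => r a = Z := by
      ext a
      simp only [mem_filter, mem_univ, true_and]
      exact ⟨fun h => h.2, fun h => ⟨h ▸ hZ, h⟩⟩
    rw [h1, Finset.sum_congr rfl (g := fun _ => 1 / (#{b | r b = Z} : ℚ))
      (fun a ha => by rw [(mem_filter.1 ha).2]), Finset.sum_const, nsmul_eq_mul]
    obtain ⟨a, ha⟩ := hr Z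
    have : 0 < #{b | r b = Z} := Finset.card_pos.2 ⟨a, by simp [ha]⟩
    have : (#{b | r b = Z} : ℚ) ≠ 0 := by positivity
    field_simp
    simp
  have hall : ∀ S : Finset V',
      #S ≤ #(S.biUnion fun Z => ({z | p z = Z} : Finset V).image fun z => q (σ z)) := by
    intro S
    have : (#S : ℚ) ≤
        #(S.biUnion fun Z => ({z | p z = Z} : Finset V).image fun z => q (σ z)) := by
      rw [← weight p hp, ← weight q hq]
      calc _ = ∑ a ∈ ({a | p a ∈ S} : Finset V).map σ.toEmbedding,
              (1 / (#{b | q b = q a} : ℚ)) := by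
            rw [Finset.sum_map]
            refine Finset.sum_congr rfl fun a _ => ?_
            rw [hσ]; rfl
        _ ≤ _ := by
            refine Finset.sum_le_sum_of_subset_of_nonneg ?_ fun _ _ _ => by positivity
            intro b
            simp only [mem_map, mem_filter, mem_univ, true_and, mem_biUnion, mem_image]
            rintro ⟨a, ha, rfl⟩
            exact ⟨p a, ha, a, rfl, rfl⟩
    exact_mod_cast this
  obtain ⟨f, hf, hf'⟩ := (Finset.all_card_le_biUnion_card_iff_exists_injective _).1 hall
  have hcard : Fintype.card V' = Fintype.card W' := by
    have h1 := weight p hp univ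
    have h2 := weight q hq univ
    simp only [mem_univ, filter_true, card_univ] at h1 h2
    have : (Fintype.card V' : ℚ) = Fintype.card W' := by
      rw [← h1, ← h2, ← Equiv.sum_comp σ]
      exact Finset.sum_congr rfl fun a _ => by rw [hσ]
    exact_mod_cast this
  refine ⟨Equiv.ofBijective f ((Fintype.bijective_iff_injective_and_card f).2 ⟨hf, hcard⟩),
    fun Z => ?_⟩
  have := hf' Z
  simp only [mem_image, mem_filter, mem_univ, true_and] at this
  exact this

variable {V W V' W' : Type u}

/-- The image of a set of positions under a pair of maps: a position on the fibers is allowed if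
some representatives of it are. -/
def imageRel (p : V → V') (q : W → W') (R : V → V → W → W → Prop) (X Y : V') (X' Y' : W') : Prop :=
  ∃ x y x' y', R x y x' y' ∧ p x = X ∧ p y = Y ∧ q x' = X' ∧ q y' = Y'

variable {G : SimpleGraph V} {H : SimpleGraph W} {R : V → V → W → W → Prop}
  {p : V → V'} {q : W → W'}

lemma Strategy.backForth_imageRel [Finite V] [Finite W] (h : Strategy G H R)
    (hp : p.Surjective) (hq : q.Surjective)
    (hpq : ∀ ⦃x y x' y'⦄, R x y x' y' → (p x = p y ↔ q x' = q y')) :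
    BackForth (imageRel p q R) := by
  classical
  rintro _ _ _ _ ⟨x, y, x', y', hR, rfl, rfl, rfl, rfl⟩
  have := Fintype.ofFinite V
  have := Fintype.ofFinite W
  have := Fintype.ofSurjective p hp
  have := Fintype.ofSurjective q hq
  obtain ⟨σ, hσ⟩ := h.forth hR
  obtain ⟨τ, hτ⟩ := exists_equiv_of_card_fiber_eq hp hq σ (by
    intro z
    obtain ⟨ρ, hρ⟩ := h.forth (hσ z).2
    refine Finset.card_equiv ρ fun w => ?_
    simp only [Finset.mem_filter, Finset.mem_univ, true_and]
    rw [eq_comm, hpq (hρ w).1, eq_comm])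
  refine ⟨τ, fun Z => ?_⟩
  obtain ⟨z, rfl, hz⟩ := hτ Z
  exact ⟨⟨x, z, x', σ z, (hσ z).1, rfl, rfl, rfl, hz⟩, ⟨z, y, σ z, y', (hσ z).2, rfl, rfl, hz, rfl⟩⟩

/-- A bijection between the fibers that respects the game lifts to the vertices. -/
lemma Strategy.exists_lift (h : Strategy G H R)
    (hpq : ∀ ⦃x y x' y'⦄, R x y x' y' → (p x = p y ↔ q x' = q y')) (f : V' ≃ W')
    (hf : ∀ X, imageRel p q R X X (f X) (f X)) :
    ∃ F : V ≃ W, ∀ z, q (F z) = f (p z) ∧ R z z (F z) (F z) := by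
  have key : ∀ X : V', ∃ σ : V ≃ W, ∀ z, R z z (σ z) (σ z) ∧ (p z = X ↔ q (σ z) = f X) := by
    intro X
    obtain ⟨x, y, x', y', hR, hx, -, hx', -⟩ := hf X
    obtain ⟨σ, hσ⟩ := h.forth hR
    refine ⟨σ, fun z => ⟨h.diag_right (hσ z).1, ?_⟩⟩
    rw [← hx, eq_comm, hpq (hσ z).1, hx', hx, eq_comm]
  choose σ hσ using key
  let e : ∀ c : W', {a // (f ∘ p) a = c} ≃ {b // q b = c} := fun c =>
    (σ (f.symm c)).subtypeEquiv fun a => by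
      have := (hσ (f.symm c) a).2
      rw [Equiv.apply_symm_apply] at this
      rw [← this, Function.comp, Equiv.eq_symm_apply]
  refine ⟨Equiv.ofFiberEquiv e, fun z => ⟨Equiv.ofFiberEquiv_map e z, ?_⟩⟩
  have : Equiv.ofFiberEquiv e z = σ (f.symm (f (p z))) z := rfl
  rw [this]
  exact (hσ _ z).1

end Collapse

/-! ### Twins and pendant vertices -/

/-- The distinct vertices `x`, `y` of `S` are twins in the subgraph induced by `S`: they have the
same neighbors in `S` apart from themselves (and may be adjacent or not). -/
def TwinsIn {V : Type u} (G : SimpleGraph V) (S : Set V) (x y : V) : Prop :=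
  x ∈ S ∧ y ∈ S ∧ x ≠ y ∧ ∀ z ∈ S, z ≠ x → z ≠ y → (G.Adj x z ↔ G.Adj y z)

/-- In the subgraph induced by `S`, the only neighbor of `x` is `y`. -/
def PendantIn {V : Type u} (G : SimpleGraph V) (S : Set V) (x y : V) : Prop :=
  x ∈ S ∧ y ∈ S ∧ ∀ z ∈ S, (G.Adj x z ↔ z = y)

/-- The subgraph induced by `S` has a pair of twins or a pendant vertex. -/
def HasTwinsOrPendant {V : Type u} (G : SimpleGraph V) (S : Set V) : Prop :=
  ∃ x y, TwinsIn G S x y ∨ PendantIn G S x y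

/-- Every induced subgraph with at least two vertices has a pair of twins or a pendant vertex,
so that the graph can be reduced to a single vertex. -/
def Prunable {V : Type u} (G : SimpleGraph V) : Prop :=
  ∀ S : Set V, S.Nontrivial → HasTwinsOrPendant G S

lemma HasTwinsOrPendant.of_comap {V V' : Type u} {G : SimpleGraph V} {f : V' → V}
    (hf : f.Injective) {S : Set V'} (h : HasTwinsOrPendant G (f '' S)) :
    HasTwinsOrPendant (G.comap f) S := by
  obtain ⟨_, _, ⟨⟨x, hx, rfl⟩, ⟨y, hy, rfl⟩, hne, h⟩ | ⟨⟨x, hx, rfl⟩, ⟨y, hy, rfl⟩, h⟩⟩ := h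
  · refine ⟨x, y, .inl ⟨hx, hy, fun e => hne (e ▸ rfl), fun z hz h1 h2 => ?_⟩⟩
    exact h _ ⟨z, hz, rfl⟩ (hf.ne h1) (hf.ne h2)
  · refine ⟨x, y, .inr ⟨hx, hy, fun z hz => ?_⟩⟩
    rw [← hf.eq_iff]
    exact h _ ⟨z, hz, rfl⟩

lemma Prunable.comap {V V' : Type u} {G : SimpleGraph V} (h : Prunable G) {f : V' → V}
    (hf : f.Injective) : Prunable (G.comap f) :=
  fun _ hS => .of_comap hf (h _ (hS.image hf))

/-- The relation of being equal or twins. Although true and false twins are treated together, this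
is an equivalence relation: no vertex has both a true and a false twin. -/
def twinSetoid {V : Type u} (G : SimpleGraph V) : Setoid V where
  r x y := ∀ z, z ≠ x → z ≠ y → (G.Adj x z ↔ G.Adj y z)
  iseqv :=
    { refl := fun _ _ _ _ => Iff.rfl
      symm := fun h z h1 h2 => (h z h2 h1).symm
      trans := by
        intro x y z h1 h2 w hx hz
        by_cases hy : w = y
        · subst hy
          by_cases hxz : x = z
          · rw [hxz]
          have a := h1 z (Ne.symm hxz) (Ne.symm hz)
          have b := h2 x (Ne.symm hx) hxz
          rw [G.adj_comm x w, G.adj_comm z w, ← a, b, G.adj_comm]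
        · exact (h1 w hx hy).trans (h2 w hy hz) }

section Twins

variable {V W : Type u} {G : SimpleGraph V} {H : SimpleGraph W} {R : V → V → W → W → Prop}

lemma Strategy.twin_iff (h : Strategy G H R) {x y : V} {x' y' : W} (hR : R x y x' y') :
    twinSetoid G x y ↔ twinSetoid H x' y' := by
  obtain ⟨σ, hσ⟩ := h.forth hR
  refine σ.forall_congr fun z => ?_
  rw [ne_eq, ne_eq, ne_eq, ne_eq, G.adj_comm y, H.adj_comm y', eq_comm (b := x),
    eq_comm (b := x'), h.eq_iff (hσ z).1, h.eq_iff (hσ z).2, h.adj_iff (hσ z).1,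
    h.adj_iff (hσ z).2]

lemma adj_iff_of_twins {x y x₁ y₁ : V} (hx : twinSetoid G x₁ x) (hy : twinSetoid G y₁ y)
    (hxy : ¬ twinSetoid G x y) : G.Adj x₁ y₁ ↔ G.Adj x y := by
  have h1 : y₁ ≠ x := fun e => hxy ((twinSetoid G).symm' (e ▸ hy) |> (twinSetoid G).symm')
  have h2 : y₁ ≠ x₁ := fun e => hxy ((twinSetoid G).trans' ((twinSetoid G).symm' hx) (e ▸ hy))
  have h3 : x ≠ y := fun e => hxy (e ▸ (twinSetoid G).refl' x)
  rw [hx y₁ h2 h1, G.adj_comm, hy x h1.symm h3, G.adj_comm]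

/-- A class of twins with at least two elements is a clique if one of its elements is adjacent to
another one. -/
lemma adj_iff_exists_of_twins {x y : V} (hxy : twinSetoid G x y) (hne : x ≠ y) :
    G.Adj x y ↔ ∃ z, twinSetoid G x z ∧ G.Adj x z := by
  refine ⟨fun h => ⟨y, hxy, h⟩, fun ⟨z, hz, h⟩ => ?_⟩
  by_cases hzy : z = y
  · exact hzy ▸ h
  have hxz : x ≠ z := fun e => G.loopless.irrefl x (e ▸ h)
  rw [G.adj_comm, ← ((twinSetoid G).trans' ((twinSetoid G).symm' hz) hxy) x hxz hne]
  exact h.symm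

lemma comap_out_adj_iff {x y : V} (hxy : ¬ twinSetoid G x y) :
    (G.comap Quotient.out).Adj (⟦x⟧ : Quotient (twinSetoid G)) ⟦y⟧ ↔ G.Adj x y :=
  adj_iff_of_twins (Quotient.mk_out x) (Quotient.mk_out y) hxy

/-- A winning strategy on two graphs induces one on the graphs in which each class of twins is
replaced by one vertex. -/
lemma Strategy.quotient_twins [Finite V] [Finite W] (h : Strategy G H R) :
    Strategy (G.comap (Quotient.out (s := twinSetoid G))) (H.comap (Quotient.out (s := twinSetoid H)))
      (imageRel (Quotient.mk _) (Quotient.mk _) R) := by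
  have hpq : ∀ ⦃x y x' y'⦄, R x y x' y' →
      ((⟦x⟧ : Quotient (twinSetoid G)) = ⟦y⟧ ↔ (⟦x'⟧ : Quotient (twinSetoid H)) = ⟦y'⟧) := by
    intro x y x' y' hR
    rw [Quotient.eq, Quotient.eq, h.twin_iff hR]
  refine ⟨?_, ?_, h.backForth_imageRel Quotient.mk_surjective Quotient.mk_surjective hpq⟩
  · rintro _ _ _ _ ⟨x, y, x', y', hR, rfl, rfl, rfl, rfl⟩
    exact hpq hR
  · rintro _ _ _ _ ⟨x, y, x', y', hR, rfl, rfl, rfl, rfl⟩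
    by_cases hxy : twinSetoid G x y
    · have h1 : (⟦x⟧ : Quotient (twinSetoid G)) = ⟦y⟧ := Quotient.sound hxy
      rw [h1, (hpq hR).1 h1]
      simp
    · rw [comap_out_adj_iff hxy, comap_out_adj_iff (mt (h.twin_iff hR).2 hxy), h.adj_iff hR]

/-- An isomorphism of the graphs obtained by collapsing twins lifts, if it respects the game. -/
lemma Strategy.exists_iso_of_quotient_twins (h : Strategy G H R)
    (f : G.comap (Quotient.out (s := twinSetoid G)) ≃g H.comap (Quotient.out (s := twinSetoid H)))
    (hf : ∀ X, imageRel (Quotient.mk _) (Quotient.mk _) R X X (f X) (f X)) :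
    ∃ F : G ≃g H, ∀ z, R z z (F z) (F z) := by
  obtain ⟨F, hF⟩ := h.exists_lift (fun x y x' y' hR => by
    rw [Quotient.eq, Quotient.eq, h.twin_iff hR]) f.toEquiv hf
  have htw : ∀ x y, twinSetoid H (F x) (F y) ↔ twinSetoid G x y := by
    intro x y
    rw [← Quotient.eq, (hF x).1, (hF y).1, f.toEquiv.injective.eq_iff, Quotient.eq]
  refine ⟨⟨F, fun {x y} => ?_⟩, fun z => (hF z).2⟩
  by_cases hxy : twinSetoid G x y
  · by_cases hne : x = y
    · simp [hne]
    rw [adj_iff_exists_of_twins hxy hne, adj_iff_exists_of_twins ((htw x y).2 hxy) (by simpa)]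
    obtain ⟨σ, hσ⟩ := h.forth (hF x).2
    exact (σ.exists_congr fun z => and_congr (h.twin_iff (hσ z).1) (h.adj_iff (hσ z).1)).symm
  · have h1 := f.map_adj_iff (v := ⟦x⟧) (w := ⟦y⟧)
    rw [comap_out_adj_iff hxy] at h1
    rw [← h1, ← comap_out_adj_iff (mt (htw x y).1 hxy), (hF x).1, (hF y).1]
    rfl

end Twins

section Pendant

variable {V W : Type u} {G : SimpleGraph V} {H : SimpleGraph W} {R : V → V → W → W → Prop}

/-- A pendant vertex: a vertex with exactly one neighbor. -/
def IsPendant (G : SimpleGraph V) (x : V) : Prop := ∃ y, ∀ z, G.Adj x z ↔ z = y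

open Classical in
/-- The vertex itself, or the neighbor of the vertex if it is pendant. -/
noncomputable def stem (G : SimpleGraph V) (x : V) : V :=
  if h : IsPendant G x then h.choose else x

lemma adj_iff_of_isPendant {x y : V} (hx : IsPendant G x) : G.Adj x y ↔ y = stem G x := by
  rw [stem, dif_pos hx]
  exact hx.choose_spec y

lemma stem_of_not_isPendant {x : V} (hx : ¬ IsPendant G x) : stem G x = x := dif_neg hx

/-- The graph has no component consisting of two pendant vertices. -/
def NoPendantEdge (G : SimpleGraph V) : Prop :=
  ∀ ⦃x y⦄, IsPendant G x → G.Adj x y → ¬ IsPendant G y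

lemma NoPendantEdge.not_isPendant_stem (hG : NoPendantEdge G) (x : V) :
    ¬ IsPendant G (stem G x) := by
  by_cases hx : IsPendant G x
  · exact hG hx ((adj_iff_of_isPendant hx).2 rfl)
  · rwa [stem_of_not_isPendant hx]

/-- The two endpoints of an isolated edge are twins. -/
lemma noPendantEdge_of_twins_eq (hG : ∀ x y, twinSetoid G x y → x = y) : NoPendantEdge G := by
  intro x y hx hxy hy
  have h1 := (adj_iff_of_isPendant hx).1 hxy
  have h2 := (adj_iff_of_isPendant hy).1 hxy.symm
  refine hxy.ne (hG x y fun z hzx hzy => ?_)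
  rw [adj_iff_of_isPendant hx, adj_iff_of_isPendant hy, ← h1, ← h2]
  simp [hzx, hzy]

lemma Strategy.isPendant_iff (h : Strategy G H R) {x y : V} {x' y' : W} (hR : R x y x' y') :
    IsPendant G x ↔ IsPendant H x' := by
  obtain ⟨σ, hσ⟩ := h.forth hR
  refine σ.exists_congr fun z => σ.forall_congr fun w => ?_
  rw [h.adj_iff (hσ w).1, σ.injective.eq_iff]

lemma Strategy.isPendant_iff_right (h : Strategy G H R) {x y : V} {x' y' : W}
    (hR : R x y x' y') : IsPendant G y ↔ IsPendant H y' :=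
  h.isPendant_iff (h.diag_right hR)

lemma Strategy.noPendantEdge (h : Strategy G H R) {x y : V} {x' y' : W} (hR : R x y x' y')
    (hG : NoPendantEdge G) : NoPendantEdge H := by
  intro a' b' ha hab hb
  obtain ⟨a, haR⟩ := h.exists_diag hR a'
  obtain ⟨σ, hσ⟩ := h.forth haR
  have hb' := (hσ (σ.symm b')).1
  rw [Equiv.apply_symm_apply] at hb'
  exact hG ((h.isPendant_iff haR).2 ha) ((h.adj_iff hb').2 hab)
    ((h.isPendant_iff_right hb').2 hb)

lemma Strategy.stem_left (h : Strategy G H R) {x y : V} {x' y' : W} (hR : R x y x' y') :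
    R (stem G x) y (stem H x') y' := by
  by_cases hx : IsPendant G x
  · obtain ⟨σ, hσ⟩ := h.forth hR
    have h1 := (h.adj_iff (hσ (stem G x)).1).1 ((adj_iff_of_isPendant hx).2 rfl)
    rw [adj_iff_of_isPendant ((h.isPendant_iff hR).1 hx)] at h1
    rw [← h1]
    exact (hσ _).2
  · rwa [stem_of_not_isPendant hx, stem_of_not_isPendant (mt (h.isPendant_iff hR).2 hx)]

lemma Strategy.stem_right (h : Strategy G H R) {x y : V} {x' y' : W} (hR : R x y x' y') :
    R x (stem G y) x' (stem H y') := by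
  by_cases hy : IsPendant G y
  · obtain ⟨σ, hσ⟩ := h.forth hR
    have h1 := (h.adj_iff (hσ (stem G y)).2).1 ((adj_iff_of_isPendant hy).2 rfl).symm
    rw [H.adj_comm, adj_iff_of_isPendant ((h.isPendant_iff_right hR).1 hy)] at h1
    rw [← h1]
    exact (hσ _).1
  · rwa [stem_of_not_isPendant hy, stem_of_not_isPendant (mt (h.isPendant_iff_right hR).2 hy)]

/-- `stem` as a map to the vertices that are not pendant. -/
noncomputable def stemMap (hG : NoPendantEdge G) (x : V) : {x // ¬ IsPendant G x} :=
  ⟨stem G x, hG.not_isPendant_stem x⟩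

lemma stemMap_surjective (hG : NoPendantEdge G) : (stemMap hG).Surjective :=
  fun x => ⟨x.1, Subtype.ext (stem_of_not_isPendant x.2)⟩

lemma Strategy.stemMap_eq_iff (h : Strategy G H R) (hG : NoPendantEdge G) (hH : NoPendantEdge H)
    {x y : V} {x' y' : W} (hR : R x y x' y') :
    stemMap hG x = stemMap hG y ↔ stemMap hH x' = stemMap hH y' := by
  rw [stemMap, stemMap, Subtype.mk_eq_mk, h.eq_iff (h.stem_left (h.stem_right hR))]
  exact Subtype.mk_eq_mk.symm

/-- A winning strategy on two graphs induces one on the graphs with the pendant vertices removed. -/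
lemma Strategy.remove_pendant [Finite V] [Finite W] (h : Strategy G H R)
    (hG : NoPendantEdge G) (hH : NoPendantEdge H) :
    Strategy (G.comap (Subtype.val : {x // ¬ IsPendant G x} → V))
      (H.comap (Subtype.val : {x // ¬ IsPendant H x} → W))
      (imageRel (stemMap hG) (stemMap hH) R) := by
  refine ⟨?_, ?_, h.backForth_imageRel (stemMap_surjective hG) (stemMap_surjective hH)
    fun _ _ _ _ => h.stemMap_eq_iff hG hH⟩
  · rintro _ _ _ _ ⟨x, y, x', y', hR, rfl, rfl, rfl, rfl⟩
    exact h.stemMap_eq_iff hG hH hR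
  · rintro _ _ _ _ ⟨x, y, x', y', hR, rfl, rfl, rfl, rfl⟩
    exact h.adj_iff (h.stem_left (h.stem_right hR))

lemma NoPendantEdge.adj_iff (hG : NoPendantEdge G) {x y : V} (hx : IsPendant G x) :
    G.Adj x y ↔ ¬ IsPendant G y ∧ stemMap hG y = stemMap hG x := by
  rw [adj_iff_of_isPendant hx, stemMap, stemMap, Subtype.mk_eq_mk]
  constructor
  · rintro rfl
    exact ⟨hG.not_isPendant_stem x, stem_of_not_isPendant (hG.not_isPendant_stem x)⟩
  · rintro ⟨h1, h2⟩
    rw [← h2, stem_of_not_isPendant h1]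

/-- An isomorphism of the graphs without the pendant vertices extends, if it respects the game. -/
lemma Strategy.exists_iso_of_remove_pendant (h : Strategy G H R)
    (hG : NoPendantEdge G) (hH : NoPendantEdge H)
    (f : G.comap (Subtype.val : {x // ¬ IsPendant G x} → V) ≃g
      H.comap (Subtype.val : {x // ¬ IsPendant H x} → W))
    (hf : ∀ X, imageRel (stemMap hG) (stemMap hH) R X X (f X) (f X)) :
    ∃ F : G ≃g H, ∀ z, R z z (F z) (F z) := by
  obtain ⟨F, hF⟩ := h.exists_lift (fun _ _ _ _ => h.stemMap_eq_iff hG hH) f.toEquiv hf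
  have hpend : ∀ x, IsPendant H (F x) ↔ IsPendant G x := fun x => (h.isPendant_iff (hF x).2).symm
  have hpen : ∀ x y, IsPendant G x → (H.Adj (F x) (F y) ↔ G.Adj x y) := by
    intro x y hx
    rw [hG.adj_iff hx, hH.adj_iff ((hpend x).2 hx), hpend, (hF x).1, (hF y).1,
      f.toEquiv.injective.eq_iff]
  refine ⟨⟨F, fun {x y} => ?_⟩, fun z => (hF z).2⟩
  by_cases hx : IsPendant G x
  · exact hpen x y hx
  by_cases hy : IsPendant G y
  · rw [H.adj_comm, G.adj_comm]
    exact hpen y x hy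
  have h1 := f.map_adj_iff (v := stemMap hG x) (w := stemMap hG y)
  change H.Adj (f.toEquiv _).1 (f.toEquiv _).1 ↔ G.Adj (stem G x) (stem G y) at h1
  rw [← (hF x).1, ← (hF y).1] at h1
  change H.Adj (stem H (F x)) (stem H (F y)) ↔ _ at h1
  rwa [stem_of_not_isPendant hx, stem_of_not_isPendant hy,
    stem_of_not_isPendant (mt (hpend x).1 hx), stem_of_not_isPendant (mt (hpend y).1 hy)] at h1

end Pendant

/-- If Duplicator has a winning strategy on a prunable graph and any other graph, then the graphs
are isomorphic. The isomorphism respects the strategy, which makes the induction work. -/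
theorem Strategy.exists_iso (n : ℕ) {V W : Type u} [Finite V] [Finite W] {G : SimpleGraph V}
    {H : SimpleGraph W} {R : V → V → W → W → Prop} (hn : Nat.card V = n) (hG : Prunable G)
    (h : Strategy G H R) {x y : V} {x' y' : W} (hR : R x y x' y') :
    ∃ F : G ≃g H, ∀ z, R z z (F z) (F z) := by
  induction n using Nat.strong_induction_on generalizing V W with
  | _ n ih =>
  subst hn
  by_cases htw : ∃ a b, twinSetoid G a b ∧ a ≠ b
  · obtain ⟨a, b, hab, hne⟩ := htw
    have hlt : Nat.card (Quotient (twinSetoid G)) < Nat.card V :=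
      (Nat.card_le_card_of_surjective _ Quotient.mk_surjective).lt_of_ne fun he =>
        hne (((Nat.bijective_iff_surjective_and_card _).2 ⟨Quotient.mk_surjective, he.symm⟩).1
          (Quotient.sound hab))
    obtain ⟨f, hf⟩ := ih _ hlt rfl (hG.comap Quotient.out_injective) h.quotient_twins
      ⟨x, y, x', y', hR, rfl, rfl, rfl, rfl⟩
    exact h.exists_iso_of_quotient_twins f hf
  · have htw' : ∀ a b, twinSetoid G a b → a = b := by simpa using htw
    obtain hV | hV := subsingleton_or_nontrivial V
    · obtain ⟨σ, hσ⟩ := h.forth hR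
      have hW : Subsingleton W := σ.symm.subsingleton
      refine ⟨⟨σ, fun {a b} => ?_⟩, fun z => h.diag_right (hσ z).1⟩
      rw [Subsingleton.elim b a]
      simp
    obtain ⟨a, b, ⟨-, -, hne, hab⟩ | ⟨-, -, hab⟩⟩ := hG Set.univ Set.nontrivial_univ
    · exact absurd (htw' a b fun z => hab z trivial) hne
    have hG' := noPendantEdge_of_twins_eq htw'
    have hH' := h.noPendantEdge hR hG'
    have hlt : Nat.card {x // ¬ IsPendant G x} < Nat.card V :=
      Finite.card_subtype_lt (x := a) (not_not.2 ⟨b, fun z => hab z trivial⟩)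
    obtain ⟨f, hf⟩ := ih _ hlt rfl (hG.comap Subtype.val_injective) (h.remove_pendant hG' hH')
      ⟨x, y, x', y', hR, rfl, rfl, rfl, rfl⟩
    exact h.exists_iso_of_remove_pendant hG' hH' f hf

/-! ### Distance-hereditary graphs are prunable -/

/-- A walk form of distance-heredity: inside the support of any walk there is a walk between the
same vertices that is as short as any walk in the graph. -/
def WalkHereditary {V : Type u} (G : SimpleGraph V) : Prop :=
  ∀ ⦃a b⦄ (q q' : G.Walk a b), ∃ r : G.Walk a b, r.support ⊆ q.support ∧ r.length ≤ q'.length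

lemma exists_walk_of_induce {V : Type u} {G : SimpleGraph V} {S : Set V} {a b : S}
    (r : (G.induce S).Walk a b) :
    ∃ r' : G.Walk a b, r'.length = r.length ∧ r'.support = r.support.map Subtype.val := by
  induction r with
  | nil => exact ⟨.nil, rfl, rfl⟩
  | cons hadj r ih =>
    obtain ⟨r', h1, h2⟩ := ih
    exact ⟨.cons (SimpleGraph.induce_adj.1 hadj) r', by simp [h1], by simp [h2]⟩

lemma exists_induce_walk {V : Type u} {G : SimpleGraph V} {S : Set V} {a b : S}
    (r : G.Walk a b) (hr : ∀ z ∈ r.support, z ∈ S) :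
    ∃ r' : (G.induce S).Walk a b, r'.length = r.length ∧
      r'.support.map Subtype.val = r.support := by
  obtain ⟨a, ha⟩ := a
  obtain ⟨b, hb⟩ := b
  change G.Walk a b at r
  induction r with
  | nil => exact ⟨.nil, rfl, rfl⟩
  | cons hadj r ih =>
    have hr' : ∀ z ∈ r.support, z ∈ S := fun z hz => hr z (by simp [hz])
    obtain ⟨r', h1, h2⟩ := ih (hr' _ r.start_mem_support) hb hr'
    exact ⟨.cons (SimpleGraph.induce_adj.2 hadj) r', by simp [h1], by simp [h2]⟩

lemma DistanceHereditary.walkHereditary {V : Type u} {G : SimpleGraph V}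
    (h : DistanceHereditary V G) : WalkHereditary G := by
  intro a b q q'
  have hc := q.connected_induce_support
  obtain ⟨r, hr⟩ := hc.exists_walk_length_eq_dist ⟨a, q.start_mem_support⟩ ⟨b, q.end_mem_support⟩
  obtain ⟨r', h1, h2⟩ := exists_walk_of_induce r
  refine ⟨r', ?_, ?_⟩
  · intro z hz
    rw [h2, List.mem_map] at hz
    obtain ⟨w, -, rfl⟩ := hz
    exact w.2
  · rw [h1, hr, h _ hc]
    exact SimpleGraph.dist_le q'

lemma WalkHereditary.induce {V : Type u} {G : SimpleGraph V} (h : WalkHereditary G) (S : Set V) :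
    WalkHereditary (G.induce S) := by
  intro a b q q'
  obtain ⟨p, -, hp⟩ := exists_walk_of_induce q
  obtain ⟨p', hp', -⟩ := exists_walk_of_induce q'
  obtain ⟨r, hr, hl⟩ := h p p'
  rw [hp] at hr
  obtain ⟨r', h1, h2⟩ := exists_induce_walk r fun z hz => by
    obtain ⟨w, -, rfl⟩ := List.mem_map.1 (hr hz)
    exact w.2
  refine ⟨r', fun z hz => ?_, by omega⟩
  rw [← h2] at hr
  obtain ⟨w, hw, e⟩ := List.mem_map.1 (hr (List.mem_map_of_mem hz))
  rwa [← Subtype.ext e]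

section Levels

variable {V : Type u} {G : SimpleGraph V}

/-- Vertices at distance two have a common neighbor on every walk between them. -/
lemma WalkHereditary.exists_common_neighbor (h : WalkHereditary G) {a b m : V} (hne : a ≠ b)
    (hab : ¬ G.Adj a b) (ham : G.Adj a m) (hmb : G.Adj m b) (q : G.Walk a b) :
    ∃ w ∈ q.support, G.Adj a w ∧ G.Adj w b := by
  obtain ⟨r, hr, hl⟩ := h q (.cons ham (.cons hmb .nil))
  rcases r with _ | ⟨h1, _ | ⟨h2, _ | ⟨h3, r⟩⟩⟩
  · exact absurd rfl hne
  · exact absurd h1 hab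
  · exact ⟨_, hr (by simp), h1, h2⟩
  · simp at hl

lemma exists_adj_dist_eq (hG : G.Connected) {u x : V} {k : ℕ} (hx : G.dist u x = k + 1) :
    ∃ p, G.Adj p x ∧ G.dist u p = k := by
  obtain ⟨r, hr⟩ := hG.exists_walk_length_eq_dist x u
  rw [G.dist_comm, hx] at hr
  match r with
  | .nil => simp at hr
  | .cons (v := p) h1 r =>
    refine ⟨p, h1.symm, ?_⟩
    have h2 := SimpleGraph.dist_le r
    rw [G.dist_comm] at h2
    have h3 := hG.dist_triangle (u := u) (v := p) (w := x)
    rw [SimpleGraph.dist_eq_one_iff_adj.2 h1.symm] at h3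
    simp at hr
    omega

lemma dist_le_of_adj (hG : G.Connected) (u : V) {x y : V} (h : G.Adj x y) :
    G.dist u y ≤ G.dist u x + 1 := by
  have := hG.dist_triangle (u := u) (v := x) (w := y)
  rwa [SimpleGraph.dist_eq_one_iff_adj.2 h] at this

lemma eq_of_mem_support_geodesic {u p z : V} (r : G.Walk u p) (hr : r.length = G.dist u p)
    (hz : z ∈ r.support) (hd : G.dist u p ≤ G.dist u z) : z = p := by
  classical
  have h1 := SimpleGraph.dist_le (r.takeUntil z hz)
  have h2 := congrArg SimpleGraph.Walk.length (r.take_spec hz)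
  rw [SimpleGraph.Walk.length_append] at h2
  exact SimpleGraph.Walk.eq_of_length_eq_zero (p := r.dropUntil z hz) (by omega)

/-- Vertices at distance `k + 1` from `u` that are joined by a walk not coming closer to `u` have
the same neighbors at distance `k`: the union of the walk and of a geodesic from `u` to such a
neighbor `p` of one end is connected, so it contains a geodesic from `u` to the other end, which
can only pass through `p`. -/
lemma WalkHereditary.adj_of_walk (h : WalkHereditary G) (hG : G.Connected) {u p x y : V} {k : ℕ}
    (hp : G.dist u p = k) (hpx : G.Adj p x) (hy : G.dist u y = k + 1) (q : G.Walk x y)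
    (hq : ∀ z ∈ q.support, k + 1 ≤ G.dist u z) : G.Adj p y := by
  obtain ⟨g, hg⟩ := hG.exists_walk_length_eq_dist u p
  obtain ⟨m, hm⟩ := hG.exists_walk_length_eq_dist u y
  obtain ⟨r, hr, hl⟩ := h (g.append (.cons hpx q)) m
  have hnil : ¬ r.Nil := by
    intro hn
    rw [hn.eq, G.dist_self] at hy
    omega
  have hadj := r.adj_penultimate hnil
  have hlast : G.dist u r.penultimate ≤ k := by
    have h1 := SimpleGraph.dist_le (r.dropLast)
    have h2 : r.dropLast.length + 1 = r.length := r.length_dropLast_add_one hnil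
    omega
  have hmem : r.penultimate ∈ _ := hr (r.getVert_mem_support _)
  rw [SimpleGraph.Walk.mem_support_append_iff, SimpleGraph.Walk.support_cons, List.mem_cons]
    at hmem
  have hle := dist_le_of_adj hG u hadj
  have : r.penultimate = p := by
    obtain hmem | hmem | hmem := hmem
    · exact eq_of_mem_support_geodesic g hg hmem (by omega)
    · exact hmem
    · have := hq _ hmem
      omega
  exact this ▸ hadj

end Levels

section Structure

variable {V : Type u} {G : SimpleGraph V}

/-- If all proper induced subgraphs have twins or pendant vertices, then a module with a common
neighbor `u` outside contains twins. If the module has a pendant vertex `x` with neighbor `y`, then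
all neighbors of `y` in the module form a smaller module, as otherwise there would be an induced
path on four vertices all adjacent to `u`. -/
lemma WalkHereditary.exists_twins_of_module [Finite V] (h : WalkHereditary G)
    (ih : ∀ S : Set V, S ≠ Set.univ → S.Nontrivial → HasTwinsOrPendant G S) (n : ℕ) (M : Set V)
    (hn : M.ncard = n) (hM : M.Nontrivial)
    (hmod : ∀ z ∉ M, ∀ x ∈ M, ∀ y ∈ M, G.Adj z x → G.Adj z y)
    {u : V} (huM : u ∉ M) (hu : ∀ x ∈ M, G.Adj u x) : ∃ x y, TwinsIn G Set.univ x y := by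
  induction n using Nat.strong_induction_on generalizing M u with
  | _ n IH =>
  have twins : ∀ x y, TwinsIn G M x y → TwinsIn G Set.univ x y := by
    rintro x y ⟨hx, hy, hne, hxy⟩
    refine ⟨trivial, trivial, hne, fun z _ h1 h2 => ?_⟩
    by_cases hz : z ∈ M
    · exact hxy z hz h1 h2
    rw [G.adj_comm, G.adj_comm y]
    exact ⟨hmod z hz x hx y hy, hmod z hz y hy x hx⟩
  obtain ⟨x, y, hxy | ⟨hx, hy, hpend⟩⟩ := ih M (fun e => huM (e ▸ trivial)) hM
  · exact ⟨x, y, twins x y hxy⟩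
  have hxy : G.Adj x y := (hpend y hy).2 rfl
  by_cases hA : ∃ a ∈ M, a ≠ x ∧ G.Adj y a
  swap
  · push Not at hA
    refine ⟨x, y, twins x y ⟨hx, hy, hxy.ne, fun z hz h1 h2 => ?_⟩⟩
    rw [hpend z hz]
    exact iff_of_false h2 (hA z hz h1)
  obtain ⟨a, haM, hax, hya⟩ := hA
  have hsub : M ∩ G.neighborSet y ⊂ M :=
    ⟨Set.inter_subset_left, fun hs => G.loopless.irrefl y (hs hy).2⟩
  refine IH _ (hn ▸ Set.ncard_lt_ncard hsub) (M ∩ G.neighborSet y) rfl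
    ⟨x, ⟨hx, hxy.symm⟩, a, ⟨haM, hya⟩, hax.symm⟩ ?_ (u := y)
    (fun hs => G.loopless.irrefl y hs.2) (fun z hz => hz.2)
  rintro z hz v ⟨hvM, hyv⟩ w ⟨hwM, hyw⟩ hzv
  rw [SimpleGraph.mem_neighborSet] at hyv hyw
  by_cases hzM : z ∈ M
  swap
  · exact hmod z hzM v hvM w hwM hzv
  have hyz : ¬ G.Adj y z := fun hyz => hz ⟨hzM, hyz⟩
  by_contra hzw
  -- either `z = y` or `x, y, v, z` is an induced path
  have hzy : z ≠ y := fun e => hzw (e ▸ hyw)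
  have hxz : ¬ G.Adj x z := fun e => hzy ((hpend z hzM).1 e)
  have hne : x ≠ z := fun e => hyz (e ▸ hxy.symm)
  obtain ⟨t, ht, hxt, htz⟩ := h.exists_common_neighbor hne hxz (hu x hx).symm (hu z hzM)
    (.cons hxy (.cons hyv (.cons hzv.symm .nil)))
  have hxv : G.Adj x v → v = y := (hpend v hvM).1
  simp only [SimpleGraph.Walk.support_cons, SimpleGraph.Walk.support_nil, List.mem_cons,
    List.not_mem_nil, or_false] at ht
  obtain rfl | rfl | rfl | rfl := ht
  · exact G.loopless.irrefl _ hxt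
  · exact hyz htz
  · exact hyv.ne (hxv hxt).symm
  · exact hxz hxt

/-- The inductive step of the existence of twins or pendant vertices, in the connected case. The
vertices are arranged by their distance to a vertex `u`. If the last level contains an edge, then
a component of it is a module. Otherwise the neighborhood of a vertex of the last level with the
fewest neighbors is a module (or a single vertex). -/
lemma WalkHereditary.hasTwinsOrPendant_of_connected [Finite V] [Nontrivial V]
    (h : WalkHereditary G) (hG : G.Connected)
    (ih : ∀ S : Set V, S ≠ Set.univ → S.Nontrivial → HasTwinsOrPendant G S) :
    HasTwinsOrPendant G Set.univ := by
  obtain ⟨u⟩ := hG.nonempty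
  obtain ⟨t, ht⟩ := Finite.exists_max (G.dist u)
  obtain ⟨u', hu'⟩ := exists_ne u
  obtain ⟨k, hk⟩ : ∃ k, G.dist u t = k + 1 :=
    ⟨G.dist u t - 1, by have := hG.pos_dist_of_ne hu'.symm; have := ht u'; omega⟩
  rw [hk] at ht
  have hadj : ∀ {x y}, G.Adj x y → G.dist u y ≤ G.dist u x + 1 := dist_le_of_adj hG u
  have of_module : ∀ M : Set V, M.Nontrivial →
      (∀ z ∉ M, ∀ x ∈ M, ∀ y ∈ M, G.Adj z x → G.Adj z y) →
      ∀ p ∉ M, (∀ x ∈ M, G.Adj p x) → HasTwinsOrPendant G Set.univ := by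
    intro M h1 h2 p h3 h4
    obtain ⟨x, y, hxy⟩ := h.exists_twins_of_module ih _ M rfl h1 h2 h3 h4
    exact ⟨x, y, .inl hxy⟩
  by_cases hedge : ∃ x y, G.Adj x y ∧ G.dist u x = k + 1 ∧ G.dist u y = k + 1
  · obtain ⟨x, y, hxy, hx, hy⟩ := hedge
    let M : Set V := {z | ∃ q : G.Walk x z, ∀ w ∈ q.support, G.dist u w = k + 1}
    have hlev : ∀ z ∈ M, G.dist u z = k + 1 := fun z ⟨q, hq⟩ => hq z q.end_mem_support
    have hxM : x ∈ M := ⟨.nil, by simpa using hx⟩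
    have hyM : y ∈ M := ⟨.cons hxy .nil, by simp [hx, hy]⟩
    have hlow : ∀ z ∉ M, ∀ a ∈ M, ∀ b ∈ M, G.dist u z = k → G.Adj z a → G.Adj z b := by
      rintro z - a ⟨q, hq⟩ b ⟨q', hq'⟩ hz hza
      refine h.adj_of_walk hG hz hza (hq' _ q'.end_mem_support) (q.reverse.append q') ?_
      intro w hw
      rw [SimpleGraph.Walk.mem_support_append_iff, SimpleGraph.Walk.support_reverse,
        List.mem_reverse] at hw
      exact (hw.elim (hq w) (hq' w)).ge
    obtain ⟨p, hpx, hp⟩ := exists_adj_dist_eq hG hx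
    have hpM : p ∉ M := fun hm => by have := hlev p hm; omega
    refine of_module M ⟨x, hxM, y, hyM, hxy.ne⟩ (fun z hz a ha b hb hza => ?_) p hpM
      (fun a ha => hlow p hpM x hxM a ha hp hpx)
    refine hlow z hz a ha b hb ?_ hza
    have h1 := hadj hza
    have h2 := hlev a ha
    have h3 := ht z
    by_contra h4
    obtain ⟨q, hq⟩ := ha
    refine hz ⟨q.concat hza.symm, fun w hw => ?_⟩
    rw [SimpleGraph.Walk.support_concat, List.mem_append,
      List.mem_singleton] at hw
    obtain hw | rfl := hw
    · exact hq w hw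
    · omega
  -- now the last level has no edges, so its vertices have all their neighbors one level below
  push Not at hedge
  obtain ⟨v, hv, hmin⟩ := Set.exists_min_image {v | G.dist u v = k + 1}
    (fun v => (G.neighborSet v).ncard) (Set.toFinite _) ⟨t, hk⟩
  have hlev : ∀ {v x}, G.dist u v = k + 1 → G.Adj v x → G.dist u x = k := by
    intro v x hv hvx
    have h1 := hedge v x hvx hv
    have h2 := hadj hvx.symm
    have h3 := ht x
    omega
  obtain ⟨x₀, hx₀, hdx₀⟩ := exists_adj_dist_eq hG hv
  by_cases hpend : (G.neighborSet v).Nontrivial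
  swap
  · refine ⟨v, x₀, .inr ⟨trivial, trivial, fun z _ => ⟨fun hz => ?_, fun e => e ▸ hx₀.symm⟩⟩⟩
    exact Set.not_nontrivial_iff.1 hpend hz hx₀.symm
  -- the level below contains two vertices, so it is not `{u}`
  obtain ⟨j, rfl⟩ : ∃ j, k = j + 1 := by
    obtain ⟨a, ha, b, hb, hne⟩ := hpend
    refine ⟨k - 1, ?_⟩
    by_contra hk0
    have h1 := hlev hv ha
    have h2 := hlev hv hb
    have h3 : k = 0 := by omega
    rw [h3, hG.dist_eq_zero_iff] at h1 h2
    exact hne (h1.symm.trans h2)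
  refine of_module _ hpend ?_ v (G.loopless.irrefl v) (fun _ => id)
  intro z hz x hx y hy hzx
  have hvz : ¬ G.Adj v z := hz
  have hvx : G.Adj v x := hx
  have hvy : G.Adj v y := hy
  have hdx := hlev hv hx
  have hdy := hlev hv hy
  have hv' : G.dist u v = j + 1 + 1 := hv
  by_contra hzy
  have hzv : v ≠ z := fun e => hzy (e ▸ hvy)
  have no_adj : ∀ {w}, G.dist u w = j → ¬ G.Adj v w := fun hw e => by
    have := hlev hv e
    omega
  -- unless `z` lies below `x` and `y`, it lies at distance two from `v`, and a walk that goes from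
  -- `v` to `z` through a neighbor `w` below `y` contains no common neighbor of `v` and `z`
  obtain ⟨w, hwy, hw⟩ := exists_adj_dist_eq hG hdy
  have h1 := hadj hzx
  have h2 := hadj hzx.symm
  obtain hdz | hdz | hdz : G.dist u z = j ∨ G.dist u z = j + 1 ∨ G.dist u z = j + 2 := by omega
  · exact hzy (h.adj_of_walk hG hdz hzx hdy (.cons hvx.symm (.cons hvy .nil))
      (by simp; omega))
  · have hwz := h.adj_of_walk hG hw hwy hdz (.cons hvy.symm (.cons hvx (.cons hzx.symm .nil)))
      (by simp; omega)
    obtain ⟨s, hs, hvs, hsz⟩ := h.exists_common_neighbor hzv hvz hvx hzx.symm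
      (.cons hvy (.cons hwy.symm (.cons hwz .nil)))
    simp only [SimpleGraph.Walk.support_cons, SimpleGraph.Walk.support_nil, List.mem_cons,
      List.not_mem_nil, or_false] at hs
    obtain rfl | rfl | rfl | rfl := hs
    · exact G.loopless.irrefl _ hvs
    · exact hzy hsz.symm
    · exact no_adj hw hvs
    · exact hvz hvs
  · -- `z` is in the last level, so by minimality it has a neighbor `c` that `v` does not have
    obtain ⟨c, hzc, hvc⟩ : ∃ c, G.Adj z c ∧ ¬ G.Adj v c := by
      by_contra hc
      push Not at hc
      have hss : G.neighborSet z ⊂ G.neighborSet v := ⟨fun c hc' => hc c hc', fun hs => hzy (hs hy)⟩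
      exact absurd (hmin z hdz) (not_le.2 (Set.ncard_lt_ncard hss))
    have hdc := hlev hdz hzc
    have hwc := h.adj_of_walk hG hw hwy hdc
      (.cons hvy.symm (.cons hvx (.cons hzx.symm (.cons hzc .nil)))) (by simp; omega)
    obtain ⟨s, hs, hvs, hsz⟩ := h.exists_common_neighbor hzv hvz hvx hzx.symm
      (.cons hvy (.cons hwy.symm (.cons hwc (.cons hzc.symm .nil))))
    simp only [SimpleGraph.Walk.support_cons, SimpleGraph.Walk.support_nil, List.mem_cons,
      List.not_mem_nil, or_false] at hs
    obtain rfl | rfl | rfl | rfl | rfl := hs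
    · exact G.loopless.irrefl _ hvs
    · exact hzy hsz.symm
    · exact no_adj hw hvs
    · exact hvc hvs
    · exact hvz hvs

lemma HasTwinsOrPendant.of_induce {S : Set V} {T : Set S} (h : HasTwinsOrPendant (G.induce S) T) :
    HasTwinsOrPendant G (Subtype.val '' T) := by
  obtain ⟨x, y, ⟨hx, hy, hne, h⟩ | ⟨hx, hy, h⟩⟩ := h
  · refine ⟨x, y, .inl ⟨⟨x, hx, rfl⟩, ⟨y, hy, rfl⟩, Subtype.val_injective.ne hne, ?_⟩⟩
    rintro _ ⟨z, hz, rfl⟩ h1 h2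
    exact h z hz (fun e => h1 (e ▸ rfl)) (fun e => h2 (e ▸ rfl))
  · refine ⟨x, y, .inr ⟨⟨x, hx, rfl⟩, ⟨y, hy, rfl⟩, ?_⟩⟩
    rintro _ ⟨z, hz, rfl⟩
    rw [Subtype.val_injective.eq_iff]
    exact h z hz

/-- A set containing all neighbors within `S` of its elements may replace `S`. -/
lemma HasTwinsOrPendant.mono {S C : Set V} (hCS : C ⊆ S)
    (hC : ∀ x ∈ C, ∀ z ∈ S, G.Adj x z → z ∈ C) (h : HasTwinsOrPendant G C) :
    HasTwinsOrPendant G S := by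
  obtain ⟨x, y, ⟨hx, hy, hne, h⟩ | ⟨hx, hy, h⟩⟩ := h
  · refine ⟨x, y, .inl ⟨hCS hx, hCS hy, hne, fun z hz h1 h2 => ?_⟩⟩
    by_cases hzC : z ∈ C
    · exact h z hzC h1 h2
    · exact iff_of_false (fun e => hzC (hC x hx z hz e)) (fun e => hzC (hC y hy z hz e))
  · refine ⟨x, y, .inr ⟨hCS hx, hCS hy, fun z hz => ?_⟩⟩
    by_cases hzC : z ∈ C
    · exact h z hzC
    · exact iff_of_false (fun e => hzC (hC x hx z hz e)) (fun e => hzC (e ▸ hy))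

/-- Every finite distance-hereditary graph is prunable. -/
theorem WalkHereditary.prunable [Finite V] (h : WalkHereditary G) : Prunable G := by
  suffices ∀ n (S : Set V), S.ncard = n → S.Nontrivial → HasTwinsOrPendant G S from
    fun S => this _ S rfl
  intro n
  induction n using Nat.strong_induction_on with
  | _ n ih =>
  intro S hn hS
  subst hn
  have ih' : ∀ T ⊂ S, T.Nontrivial → HasTwinsOrPendant G T := fun T hT =>
    ih _ (Set.ncard_lt_ncard hT) T rfl
  have : Nontrivial S := hS.coe_sort
  by_cases hc : (G.induce S).Connected
  · have h1 := (h.induce S).hasTwinsOrPendant_of_connected hc (by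
      intro T hT hT'
      refine .of_comap Subtype.val_injective (ih' _ ⟨by simp, fun hs => hT ?_⟩
        (hT'.image Subtype.val_injective))
      refine Set.eq_univ_of_forall fun x => ?_
      obtain ⟨y, hy, e⟩ := hs x.2
      rwa [← Subtype.ext e])
    simpa using h1.of_induce
  by_cases hedge : ∃ a ∈ S, ∃ b ∈ S, G.Adj a b
  swap
  · push Not at hedge
    obtain ⟨x, hx, y, hy, hne⟩ := hS
    exact ⟨x, y, .inl ⟨hx, hy, hne, fun z hz _ _ =>
      iff_of_false (hedge x hx z hz) (hedge y hy z hz)⟩⟩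
  obtain ⟨a, ha, b, hb, hab⟩ := hedge
  -- the component of an edge is a smaller induced subgraph
  let C : Set S := {z | (G.induce S).Reachable ⟨a, ha⟩ z}
  refine HasTwinsOrPendant.mono (C := Subtype.val '' C) (by simp) ?_ (ih' _ ⟨by simp, ?_⟩ ?_)
  · rintro _ ⟨x, hx, rfl⟩ z hz hxz
    have : (G.induce S).Adj x ⟨z, hz⟩ := hxz
    exact ⟨⟨z, hz⟩, hx.trans this.reachable, rfl⟩
  · intro hs
    have hr : ∀ z, (G.induce S).Reachable ⟨a, ha⟩ z := by
      intro z
      obtain ⟨y, hy, e⟩ := hs z.2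
      rwa [← Subtype.ext e]
    exact hc ⟨fun x y => (hr x).symm.trans (hr y)⟩
  · have : (G.induce S).Adj ⟨a, ha⟩ ⟨b, hb⟩ := hab
    exact ⟨a, ⟨_, SimpleGraph.Reachable.refl _, rfl⟩, b, ⟨_, this.reachable, rfl⟩, hab.ne⟩

end Structure

/-! ### From the Weisfeiler-Leman algorithm to the game -/

lemma exists_equiv_of_map_univ_eq {α β γ : Type*} [Fintype α] [Fintype β] {f : α → γ} {g : β → γ}
    (h : (Finset.univ : Finset α).val.map f = (Finset.univ : Finset β).val.map g) :
    ∃ e : α ≃ β, ∀ a, g (e a) = f a := by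
  classical
  have key : ∀ c, Nonempty ({a // f a = c} ≃ {b // g b = c}) := by
    intro c
    have hc := congrArg (Multiset.count c) h
    rw [Multiset.count_map, Multiset.count_map] at hc
    refine ⟨Fintype.equivOfCardEq ?_⟩
    rw [Fintype.card_subtype, Fintype.card_subtype, Finset.card_def, Finset.card_def,
      Finset.filter_val, Finset.filter_val]
    simpa only [eq_comm] using hc
  exact ⟨Equiv.ofFiberEquiv fun c => (key c).some, Equiv.ofFiberEquiv_map _⟩

lemma map_univ_eq_of_equiv {α β γ : Type*} [Fintype α] [Fintype β] {f : α → γ} {g : β → γ}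
    (e : α ≃ β) (h : ∀ a, g (e a) = f a) :
    (Finset.univ : Finset α).val.map f = (Finset.univ : Finset β).val.map g := by
  rw [← Multiset.map_univ_val_equiv e, Multiset.map_map]
  exact Multiset.map_congr rfl fun a _ => (h a).symm

/-- If for every round some element of a finite type is suitable, and suitability is inherited by
earlier rounds, then one element is suitable for all rounds. -/
lemma exists_forall_of_antitone {α : Type*} [Finite α] {P : ℕ → α → Prop}
    (hP : ∀ i a, P (i + 1) a → P i a) (h : ∀ i, ∃ a, P i a) : ∃ a, ∀ i, P i a := by
  by_contra hn
  push Not at hn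
  choose N hN using hn
  obtain ⟨M, hM⟩ := (Set.finite_range N).bddAbove
  obtain ⟨a, ha⟩ := h M
  have anti : ∀ i j, i ≤ j → P j a → P i a := fun i j hij =>
    Nat.le_induction (fun h => h) (fun k _ ih h => ih (hP k a h)) j hij
  exact hN a (anti _ _ (hM ⟨a, rfl⟩) ha)

lemma atomicType_comp_iso {V W : Type u} {G : SimpleGraph V} {H : SimpleGraph W} (f : G ≃g H) {d : ℕ}
    (v : Fin d → V) : atomicType H (f ∘ v) = atomicType G v := by
  funext a b
  exact Prod.ext (propext f.injective.eq_iff) (propext f.map_adj_iff)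

section Game

variable {V W : Type u} [Fintype V] [Fintype W]

lemma color_comp_iso {G : SimpleGraph V} {H : SimpleGraph W} (f : G ≃g H) (d i : ℕ)
    (v : Fin d → V) : color H d i (f ∘ v) = color G d i v := by
  induction i generalizing v with
  | zero => exact atomicType_comp_iso f v
  | succ i ih =>
    refine Prod.ext (ih v) (map_univ_eq_of_equiv f.toEquiv fun w => ?_).symm
    refine Prod.ext ?_ (funext fun j => ?_)
    · have : Fin.snoc (α := fun _ => W) (f ∘ v) (f w) = f ∘ Fin.snoc (α := fun _ => V) v w :=
        (Fin.comp_snoc f v w).symm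
      exact (congrArg (atomicType H) this).trans (atomicType_comp_iso f _)
    · have : Function.update (f ∘ v) j (f w) = f ∘ Function.update v j w :=
        (Function.comp_update f v j w).symm
      exact (congrArg (color H d i) this).trans (ih _)

/-- Isomorphic graphs are not distinguished. -/
lemma indistinguishable_of_iso {G : SimpleGraph V} {H : SimpleGraph W} (f : G ≃g H) (d : ℕ) :
    Indistinguishable d G H := fun i =>
  map_univ_eq_of_equiv (Equiv.arrowCongr (Equiv.refl _) f.toEquiv) (color_comp_iso f d i)

/-- The positions formed by the first two entries of tuples that are never distinguished. -/
def colorRel (G : SimpleGraph V) (H : SimpleGraph W) (e : ℕ) (x y : V) (x' y' : W) : Prop :=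
  ∃ (v : Fin (e + 2) → V) (v' : Fin (e + 2) → W), (∀ i, color G (e + 2) i v = color H (e + 2) i v') ∧
    v 0 = x ∧ v 1 = y ∧ v' 0 = x' ∧ v' 1 = y'

/-- Every dimension `d ≥ 2` of the algorithm provides a winning strategy with two pebble pairs. -/
lemma strategy_colorRel (G : SimpleGraph V) (H : SimpleGraph W) (e : ℕ) :
    Strategy G H (colorRel G H e) where
  eq_iff := by
    rintro _ _ _ _ ⟨v, v', h, rfl, rfl, rfl, rfl⟩
    exact iff_of_eq (congrArg Prod.fst (congrFun (congrFun (h 0) 0) 1))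
  adj_iff := by
    rintro _ _ _ _ ⟨v, v', h, rfl, rfl, rfl, rfl⟩
    exact iff_of_eq (congrArg Prod.snd (congrFun (congrFun (h 0) 0) 1))
  forth := by
    rintro _ _ _ _ ⟨v, v', h, rfl, rfl, rfl, rfl⟩
    obtain ⟨σ, hσ⟩ := exists_forall_of_antitone
      (P := fun i (σ : V ≃ W) => ∀ z j, color G (e + 2) i (Function.update v j z) =
        color H (e + 2) i (Function.update v' j (σ z)))
      (fun i σ hσ z j => congrArg Prod.fst (hσ z j))
      (fun i => by
        obtain ⟨σ, hσ⟩ := exists_equiv_of_map_univ_eq (congrArg Prod.snd (h (i + 1)))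
        exact ⟨σ, fun z j => (congrFun (congrArg Prod.snd (hσ z)) j).symm⟩)
    refine ⟨σ, fun z => ⟨⟨_, _, fun i => hσ i z 1, ?_⟩, ⟨_, _, fun i => hσ i z 0, ?_⟩⟩⟩ <;> simp

/-- The `d`-dimensional algorithm identifies prunable graphs if `d ≥ 2`. -/
theorem Prunable.identifies {G : SimpleGraph V} (hG : Prunable G) {d : ℕ} (hd : 2 ≤ d) :
    Identifies d G := by
  intro W _ H
  refine ⟨fun h => ?_, fun ⟨f⟩ => indistinguishable_of_iso f d⟩
  obtain ⟨e, rfl⟩ : ∃ e, d = e + 2 := ⟨d - 2, by omega⟩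
  obtain ⟨φ⟩ : Nonempty ((Fin (e + 2) → V) ≃ (Fin (e + 2) → W)) :=
    ⟨(exists_equiv_of_map_univ_eq (h 0)).choose⟩
  obtain hV | ⟨⟨x⟩⟩ := isEmpty_or_nonempty V
  · have hW : IsEmpty W := ⟨fun w => hV.false (φ.symm (fun _ => w) 0)⟩
    exact ⟨⟨Equiv.equivOfIsEmpty V W, fun {a} => (hV.false a).elim⟩⟩
  obtain ⟨v', hv'⟩ := exists_forall_of_antitone
    (P := fun i (v' : Fin (e + 2) → W) => color G (e + 2) i (fun _ => x) = color H (e + 2) i v')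
    (fun i v' h => congrArg Prod.fst h)
    (fun i => by
      obtain ⟨φ, hφ⟩ := exists_equiv_of_map_univ_eq (h i)
      exact ⟨φ _, (hφ _).symm⟩)
  obtain ⟨F, -⟩ := (strategy_colorRel G H e).exists_iso _ rfl hG
    ⟨fun _ => x, v', hv', rfl, rfl, rfl, rfl⟩
  exact ⟨F⟩

end Game

/-! ### Color refinement does not suffice -/

section LowerBound

/-- The disjoint union of two triangles. -/
def twoTriangles : SimpleGraph (ULift.{u} (Fin 6)) where
  Adj x y := y.down = x.down + 2 ∨ x.down = y.down + 2
  symm := ⟨fun _ _ h => h.symm⟩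
  loopless := ⟨fun ⟨x⟩ h => by revert x; decide⟩

/-- The cycle of length six. -/
def hexagon : SimpleGraph (ULift.{u} (Fin 6)) where
  Adj x y := y.down = x.down + 1 ∨ x.down = y.down + 1
  symm := ⟨fun _ _ h => h.symm⟩
  loopless := ⟨fun ⟨x⟩ h => by revert x; decide⟩

lemma twoTriangles_adj_trans {x y z : ULift.{u} (Fin 6)} (hxy : twoTriangles.Adj x y)
    (hyz : twoTriangles.Adj y z) : x = z ∨ twoTriangles.Adj x z := by
  obtain ⟨x⟩ := x
  obtain ⟨y⟩ := y
  obtain ⟨z⟩ := z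
  have : ∀ x y z : Fin 6, (y = x + 2 ∨ x = y + 2) → (z = y + 2 ∨ y = z + 2) →
      x = z ∨ z = x + 2 ∨ x = z + 2 := by decide
  exact (this x y z hxy hyz).imp_left (congrArg ULift.up)

/-- If being equal or adjacent is transitive, then each connected component is a clique, so that
the graph is distance-hereditary. -/
lemma distanceHereditary_of_adj_trans {V : Type u} {G : SimpleGraph V}
    (h : ∀ x y z, G.Adj x y → G.Adj y z → x = z ∨ G.Adj x z) : DistanceHereditary V G := by
  intro S hS x y
  have key : ∀ {a b : S} (_ : (G.induce S).Walk a b), a = b ∨ G.Adj a b := by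
    intro a b r
    induction r with
    | nil => exact .inl rfl
    | cons hadj r ih =>
      obtain rfl | ih := ih
      · exact .inr hadj
      · exact (h _ _ _ hadj ih).imp_left Subtype.ext
  obtain ⟨r⟩ := hS.preconnected x y
  obtain rfl | hxy := key r
  · simp
  · rw [SimpleGraph.dist_eq_one_iff_adj.2 hxy, SimpleGraph.dist_eq_one_iff_adj]
    exact hxy

/-- The permutation of the residues modulo six that fixes `0` and exchanges the neighbors of `0` in
`twoTriangles` with those in `hexagon`. -/
def exchange : Equiv.Perm (Fin 6) := Equiv.swap 1 2 * Equiv.swap 4 5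

lemma exists_equiv_adj_iff (x x' : ULift.{u} (Fin 6)) :
    ∃ σ : ULift.{u} (Fin 6) ≃ ULift.{u} (Fin 6), σ x = x' ∧
      ∀ z, twoTriangles.Adj x z ↔ hexagon.Adj x' (σ z) := by
  obtain ⟨x⟩ := x
  obtain ⟨x'⟩ := x'
  refine ⟨Equiv.ulift.trans ((((Equiv.subRight x).trans exchange).trans
    (Equiv.addLeft x')).trans Equiv.ulift.symm), congrArg ULift.up ?_, fun ⟨z⟩ => ?_⟩
  · change x' + exchange (x - x) = x'
    revert x x'
    decide
  · change (z = x + 2 ∨ x = z + 2) ↔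
      (x' + exchange (z - x) = x' + 1 ∨ x' = x' + exchange (z - x) + 1)
    revert x x' z
    decide

/-- Color refinement assigns the same color to all vertices of two regular graphs of the same size
and degree. -/
lemma color_twoTriangles_eq (i : ℕ) (v v' : Fin 1 → ULift.{u} (Fin 6)) :
    color twoTriangles 1 i v = color hexagon 1 i v' := by
  induction i generalizing v v' with
  | zero =>
    funext a b
    rw [Subsingleton.elim a b]
    exact Prod.ext (by simp [color, atomicType]) (by simp [color, atomicType])
  | succ i ih =>
    obtain ⟨σ, hσ, hadj⟩ := exists_equiv_adj_iff (v 0) (v' 0)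
    refine Prod.ext (ih v v') (map_univ_eq_of_equiv σ fun w => ?_)
    refine Prod.ext ?_ (funext fun j => (ih _ _).symm)
    have h1 : ∀ a : Fin 2, (Fin.snoc (α := fun _ => ULift.{u} (Fin 6)) v' (σ w) : Fin 2 → _) a =
        σ ((Fin.snoc (α := fun _ => ULift.{u} (Fin 6)) v w : Fin 2 → _) a) := by
      intro a
      fin_cases a
      · exact hσ.symm
      · rfl
    funext a b
    refine Prod.ext ?_ ?_
    · change (_ = _) = (_ = _)
      rw [h1, h1, σ.injective.eq_iff]
    · apply propext
      fin_cases a <;> fin_cases b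
      · exact iff_of_false (hexagon.loopless.irrefl _) (twoTriangles.loopless.irrefl _)
      · exact (hadj w).symm
      · exact (SimpleGraph.adj_comm _ _ _).trans ((hadj w).symm.trans (SimpleGraph.adj_comm _ _ _))
      · exact iff_of_false (hexagon.loopless.irrefl _) (twoTriangles.loopless.irrefl _)

lemma not_identifies_one_twoTriangles : ¬ Identifies 1 twoTriangles.{u} := by
  intro h
  obtain ⟨f⟩ := (h _ hexagon).1 fun i =>
    map_univ_eq_of_equiv (Equiv.refl _) fun v => (color_twoTriangles_eq i v v).symm
  -- the hexagon contains no triangle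
  have tri : ∀ x y z : Fin 6, (y = x + 1 ∨ x = y + 1) → (z = y + 1 ∨ y = z + 1) →
      ¬ (z = x + 1 ∨ x = z + 1) := by decide
  exact tri (f ⟨0⟩).down (f ⟨2⟩).down (f ⟨4⟩).down (f.map_adj_iff.2 (.inl rfl))
    (f.map_adj_iff.2 (.inl rfl)) (f.map_adj_iff.2 (.inr rfl))

end LowerBound

lemma DistanceHereditary.graphDim_le {V : Type u} [Fintype V] {G : SimpleGraph V}
    (h : DistanceHereditary V G) : graphDim G ≤ 2 :=
  sInf_le ⟨2, rfl, by norm_num, fun _ hd => h.walkHereditary.prunable.identifies hd⟩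

lemma two_le_graphDim_twoTriangles : 2 ≤ graphDim twoTriangles.{u} := by
  refine le_sInf ?_
  rintro _ ⟨d, rfl, h1, hd⟩
  by_contra hlt
  have h2 : d < 2 := by exact_mod_cast not_le.1 hlt
  exact not_identifies_one_twoTriangles (hd 1 (by omega))

end WeisfeilerLeman

theorem mainTheorem1 :
    WeisfeilerLeman.classDim.{u} WeisfeilerLeman.DistanceHereditary.{u} = 2 := by
  refine le_antisymm (sSup_le ?_) (WeisfeilerLeman.two_le_graphDim_twoTriangles.{u}.trans ?_)
  · rintro _ ⟨V, _, G, hG, rfl⟩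
    exact hG.graphDim_le
  · exact le_sSup ⟨_, inferInstance, _, WeisfeilerLeman.distanceHereditary_of_adj_trans
      fun _ _ _ => WeisfeilerLeman.twoTriangles_adj_trans, rfl⟩
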